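/- There is a universal constant $C>0$ such that for every $n\ge 1$ and all symmetric convex bodies $K,T\subset\mathbb{R}^n$ (convex compact sets with non-empty interior satisfying $K=-K$, $T=-T$), \[ \log N(K,T)\;\le\; C\,\log(1+n)\,\log\log(2+n)\,\log N\bigl(T^\circ,(C\log(1+n))^{-1}K^\circ\bigr). \] Here $N(A,B)$ denotes the minimal number of translates of $B$, with arbitrary centres in $\mathbb{R}^n$, needed to cover $A$; $L^\circ=\{x\in\mathbb{R}^n : \langle x,y\rangle\le 1 \text{ for all } y\in L\}$ is the polar body of $L$; and $\log$ is the natural logarithm. -/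

import Mathlib

open scoped Pointwise

/-- `K` is a symmetric convex body in `ℝⁿ`: a convex compact set with non-empty interior
and `K = -K`. -/
structure IsSymmConvexBody {n : ℕ} (K : Set (EuclideanSpace ℝ (Fin n))) : Prop where
  convex : Convex ℝ K
  isCompact : IsCompact K
  nonempty_interior : (interior K).Nonempty
  symm : -K = K

/-- The polar body `L° = {x ; ⟨x, y⟩ ≤ 1 for all y ∈ L}`. -/
def polarBody {n : ℕ} (L : Set (EuclideanSpace ℝ (Fin n))) : Set (EuclideanSpace ℝ (Fin n)) :=
  {x | ∀ y ∈ L, inner ℝ x y ≤ 1}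

/-- The set of all `N` such that `K` is covered by `N` translates of `T`, with arbitrary centres. -/
def coveringCards {n : ℕ} (K T : Set (EuclideanSpace ℝ (Fin n))) : Set ℕ :=
  {N | ∃ x : Fin N → EuclideanSpace ℝ (Fin n), K ⊆ ⋃ i, (x i +ᵥ T)}

/-- The covering number `N(K, T)`: the minimal number of translates of `T` needed to cover `K`.
The minimum exists whenever `K` is compact and `T` has non-empty interior, by
`coveringCards_nonempty`. -/
noncomputable def coveringNum {n : ℕ} (K T : Set (EuclideanSpace ℝ (Fin n))) : ℕ :=
  sInf (coveringCards K T)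

/-- Finitely many translates suffice if `K` is compact and `T` has non-empty interior. -/
theorem coveringCards_nonempty {n : ℕ} {K T : Set (EuclideanSpace ℝ (Fin n))}
    (hK : IsCompact K) (hT : (interior T).Nonempty) : (coveringCards K T).Nonempty := by
  obtain ⟨t, ht⟩ := hT
  obtain ⟨s, hs⟩ := hK.elim_finite_subcover
    (fun x : EuclideanSpace ℝ (Fin n) => x +ᵥ interior T)
    (fun x => isOpen_interior.vadd x)
    (fun y _ => Set.mem_iUnion.2 ⟨y - t, Set.mem_vadd_set.2 ⟨t, ht, by simp⟩⟩)
  refine ⟨s.card, fun i => (s.equivFin.symm i : EuclideanSpace ℝ (Fin n)), fun y hy => ?_⟩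
  obtain ⟨x, hx, hyx⟩ := Set.mem_iUnion₂.1 (hs hy)
  refine Set.mem_iUnion.2 ⟨s.equivFin ⟨x, hx⟩, ?_⟩
  simpa using Set.vadd_set_mono interior_subset hyx

/-! Write `Q` for the polar of `T`. The core is a halving step (`exists_centers_halving`): suppose
`x - c` is the sum of a vector of norm at most `h` and one on which `Q` is bounded by `r`. Subtract
`s • q x`, where `q x` is the point of `Q` nearest to `s⁻¹ • (x - c)`. The remainder is normal to
`Q` at `q x`, so `Q` is bounded on it by `r + h² / (4s)`. Projection is monotone, so points whose
projections act almost equally on `X` may share a centre, with Euclidean error at most `√(s * δ)`.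
After `m` halvings a set of radius `2 ^ m / 2` is covered by `T`, each step costing one factor equal
to the number of classes of `Q`.

An Auerbach basis gives a position with `Q` in the unit ball and `T` in the ball of radius `n`, so
`m` of order `log n` suffices at one scale. For general `K`, `exists_separated_cover` chains over
scales `ρ ^ j`. The separated subsets of `Q` at alternate scales combine, with weights in powers of
`ρ⁻²`, into one separated subset of `2Q`, so the product of their cardinalities is at most one dual
covering number, however many scales there are. The two parities give the exponent `2m`. This is of
order `log n`; the iterated logarithm is only used through a positive lower bound. -/

/-! ### Covering by iterated projection -/

/-- Variational characterisation of the nearest point in a closed convex set. -/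
theorem exists_mem_inner_sub_sub_nonpos {F : Type*} [NormedAddCommGroup F] [InnerProductSpace ℝ F]
    [CompleteSpace F] {Q : Set F} (hconv : Convex ℝ Q) (hclosed : IsClosed Q) (hne : Q.Nonempty)
    (d : F) : ∃ q ∈ Q, ∀ y ∈ Q, inner ℝ (d - q) (y - q) ≤ 0 := by
  obtain ⟨q, hq, h⟩ := exists_norm_eq_iInf_of_complete_convex hne hclosed.isComplete hconv d
  exact ⟨q, hq, (norm_eq_iInf_iff_real_inner_le_zero hconv hq).1 h⟩

/-- One refinement step: if every point of `X` near the centre `c` is approximated up to an error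
`r` in the gauge polar to `Q` and `h` in the Euclidean norm, then, after splitting into the classes
`cl`, the Euclidean error is halved at the price of increasing `r` by `δ`. -/
theorem exists_centers_halving {F : Type*} [NormedAddCommGroup F] [InnerProductSpace ℝ F]
    [CompleteSpace F] {X Q : Set F} (hconv : Convex ℝ Q) (hclosed : IsClosed Q)
    (hne : Q.Nonempty) {ι : Type*} (cl : F → ι) {δ : ℝ} (hδ : 0 < δ)
    (hcl : ∀ y ∈ Q, ∀ y' ∈ Q, cl y = cl y' → ∀ x ∈ X, ∀ x' ∈ X,
      inner ℝ (y - y') (x - x') ≤ δ)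
    {r h : ℝ} (hh : 0 < h) (c : F) :
    ∃ c' : ι → F, ∀ x ∈ X, (∃ b, ‖b‖ ≤ h ∧ ∀ y ∈ Q, inner ℝ y (x - c - b) ≤ r) →
      ∃ i, ∃ b, ‖b‖ ≤ h / 2 ∧ ∀ y ∈ Q, inner ℝ y (x - c' i - b) ≤ r + δ := by
  classical
  -- This value gives both `√(s * δ) = h / 2` (Euclidean error) and `h² / (4s) = δ` (increase of
  -- `r`).
  set s : ℝ := h ^ 2 / (4 * δ) with hs
  have hs0 : 0 < s := by positivity
  have hsδ : s * δ = h ^ 2 / 4 := by rw [hs]; field_simp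
  choose q hqQ hq using fun x : F =>
    exists_mem_inner_sub_sub_nonpos hconv hclosed hne (s⁻¹ • (x - c))
  have hq' : ∀ x, ∀ y ∈ Q, inner ℝ (x - c - s • q x) (y - q x) ≤ 0 := by
    intro x y hy
    have h1 := hq x y hy
    have h2 : x - c - s • q x = s • (s⁻¹ • (x - c) - q x) := by
      rw [smul_sub, smul_inv_smul₀ hs0.ne']
    rw [h2, real_inner_smul_left]
    exact mul_nonpos_of_nonneg_of_nonpos hs0.le h1
  -- The centre may depend on the class only, so the projection of a representative replaces `q x`.
  let c' : ι → F := fun i =>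
    if hi : ∃ x ∈ X, cl (q x) = i then c + s • q hi.choose else c
  refine ⟨c', fun x hx ⟨b, hb, hr⟩ => ⟨cl (q x), ?_⟩⟩
  have hi : ∃ x' ∈ X, cl (q x') = cl (q x) := ⟨x, hx, rfl⟩
  have hc' : c' (cl (q x)) = c + s • q hi.choose := dif_pos hi
  obtain ⟨hx', hxx'⟩ := hi.choose_spec
  set x' := hi.choose
  rw [hc']
  refine ⟨s • (q x - q x'), ?_, fun y hy => ?_⟩
  · have h1 := hq' x (q x') (hqQ x')
    have h2 := hq' x' (q x) (hqQ x)
    have h3 := hcl _ (hqQ x) _ (hqQ x') hxx'.symm x hx x' hx'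
    -- Firm monotonicity of the projection: add the two variational inequalities.
    have h4 : s * ‖q x - q x'‖ ^ 2 ≤ inner ℝ (q x - q x') (x - x') := by
      rw [← real_inner_self_eq_norm_sq]
      simp only [inner_sub_left, inner_sub_right, real_inner_smul_left] at *
      rw [real_inner_comm (q x) x, real_inner_comm (q x') x, real_inner_comm (q x) x',
        real_inner_comm (q x') x', real_inner_comm (q x) (q x')] at *
      linarith
    have h5 : ‖s • (q x - q x')‖ ^ 2 ≤ (h / 2) ^ 2 := by
      rw [norm_smul, Real.norm_of_nonneg hs0.le]
      nlinarith [mul_le_mul_of_nonneg_left (h4.trans h3) hs0.le]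
    exact (sq_le_sq₀ (norm_nonneg _) (by positivity)).1 h5
  · have e : x - (c + s • q x') - s • (q x - q x') = x - c - s • q x := by
      rw [smul_sub]; abel
    rw [e]
    -- On `Q`, the functional given by the remainder is largest at `q x`, so only its value there
    -- needs a bound.
    have h1 := hq' x y hy
    have h2 := hr _ (hqQ x)
    have h3 : inner ℝ (q x) (x - c - s • q x) =
        inner ℝ (q x) (x - c - b) + inner ℝ (q x) b - s * ‖q x‖ ^ 2 := by
      rw [← real_inner_self_eq_norm_sq, ← real_inner_smul_right, ← inner_add_right,
        ← inner_sub_right]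
      congr 1; abel
    have h4 : inner ℝ (q x) b ≤ ‖q x‖ * h :=
      (real_inner_le_norm _ _).trans (mul_le_mul_of_nonneg_left hb (norm_nonneg _))
    have h5 : ‖q x‖ * h - s * ‖q x‖ ^ 2 ≤ δ := by
      have : 0 ≤ s * (s * ‖q x‖ ^ 2 - ‖q x‖ * h + δ) := by
        nlinarith [sq_nonneg (s * ‖q x‖ - h / 2)]
      nlinarith [(mul_nonneg_iff_of_pos_left hs0).1 this]
    rw [inner_sub_right, real_inner_comm, real_inner_comm (q x)] at h1
    linarith

/-- Iterating `exists_centers_halving`. -/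
theorem exists_centers_iterate {F : Type*} [NormedAddCommGroup F] [InnerProductSpace ℝ F]
    [CompleteSpace F] {X Q : Set F} (hconv : Convex ℝ Q) (hclosed : IsClosed Q)
    (hne : Q.Nonempty) {ι : Type*} [Fintype ι] (cl : F → ι) {δ : ℝ} (hδ : 0 < δ)
    (hcl : ∀ y ∈ Q, ∀ y' ∈ Q, cl y = cl y' → ∀ x ∈ X, ∀ x' ∈ X,
      inner ℝ (y - y') (x - x') ≤ δ)
    {h : ℝ} (hh : 0 < h) (hX : ∀ x ∈ X, ‖x‖ ≤ h) (m : ℕ) :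
    ∃ C : Finset F, C.card ≤ Fintype.card ι ^ m ∧ ∀ x ∈ X, ∃ c ∈ C,
      ∃ b, ‖b‖ ≤ h / 2 ^ m ∧ ∀ y ∈ Q, inner ℝ y (x - c - b) ≤ m * δ := by
  classical
  induction m with
  | zero => exact ⟨{0}, by simp, fun x hx => ⟨0, by simp, x, by simpa using hX x hx, by simp⟩⟩
  | succ m ih =>
    obtain ⟨C, hC, H⟩ := ih
    choose f hf using fun c : F => exists_centers_halving hconv hclosed hne cl hδ hcl
      (r := m * δ) (h := h / 2 ^ m) (by positivity) c
    refine ⟨C.biUnion fun c => Finset.univ.image (f c), ?_, fun x hx => ?_⟩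
    · refine (Finset.card_biUnion_le_card_mul _ _ (Fintype.card ι) fun c _ => ?_).trans ?_
      · exact Finset.card_image_le
      · rw [pow_succ]; exact Nat.mul_le_mul_right _ hC
    · obtain ⟨c, hc, hb⟩ := H x hx
      obtain ⟨i, b, hb, hr⟩ := hf c x hx hb
      refine ⟨f c i, Finset.mem_biUnion.2 ⟨c, hc, by simp⟩, b, ?_, fun y hy => ?_⟩
      · rwa [pow_succ, ← div_div]
      · have := hr y hy; push_cast; linarith

/-- A covering bound for `X` by translates of the polar of `Q`, in terms of a classification of
the elements of `Q` by their action on `X`. -/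
theorem exists_cover_of_classes {F : Type*} [NormedAddCommGroup F] [InnerProductSpace ℝ F]
    [CompleteSpace F] {X Q : Set F} (hconv : Convex ℝ Q) (hclosed : IsClosed Q)
    (hne : Q.Nonempty) (hQ : ∀ y ∈ Q, ‖y‖ ≤ 1) {ι : Type*} [Fintype ι] (cl : F → ι) {m : ℕ}
    (hm : 0 < m)
    (hcl : ∀ y ∈ Q, ∀ y' ∈ Q, cl y = cl y' → ∀ x ∈ X, ∀ x' ∈ X,
      inner ℝ (y - y') (x - x') ≤ 1 / (2 * m))
    {h : ℝ} (hh : 0 < h) (hX : ∀ x ∈ X, ‖x‖ ≤ h) (hhm : 2 * h ≤ 2 ^ m) :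
    ∃ C : Finset F, C.card ≤ Fintype.card ι ^ m ∧ ∀ x ∈ X, ∃ c ∈ C,
      ∀ y ∈ Q, inner ℝ y (x - c) ≤ 1 := by
  have hm' : (0 : ℝ) < m := by exact_mod_cast hm
  obtain ⟨C, hC, H⟩ := exists_centers_iterate hconv hclosed hne cl (δ := 1 / (2 * m))
    (by positivity) hcl hh hX m
  refine ⟨C, hC, fun x hx => ?_⟩
  obtain ⟨c, hc, b, hb, hr⟩ := H x hx
  refine ⟨c, hc, fun y hy => ?_⟩
  have h1 := hr y hy
  have h2 : inner ℝ y b ≤ 1 / 2 := by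
    refine (real_inner_le_norm y b).trans ?_
    have h3 : ‖b‖ ≤ 1 / 2 := hb.trans (by rw [div_le_iff₀ (by positivity)]; linarith)
    nlinarith [hQ y hy, norm_nonneg b, norm_nonneg y]
  have h3 : (m : ℝ) * (1 / (2 * m)) = 1 / 2 := by field_simp
  rw [inner_sub_right] at h1
  linarith

/-! ### Symmetric bodies and polars -/

theorem IsSymmConvexBody.neg_mem {n : ℕ} {K : Set (EuclideanSpace ℝ (Fin n))}
    (hK : IsSymmConvexBody K) {x : EuclideanSpace ℝ (Fin n)} (hx : x ∈ K) : -x ∈ K := by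
  rw [← hK.symm]; simpa using hx

/-- A convex set that is closed under negation contains half the difference of its points. -/
theorem Convex.half_smul_sub_mem {E : Type*} [AddCommGroup E] [Module ℝ E] {K : Set E}
    (hK : Convex ℝ K) (hneg : ∀ x ∈ K, -x ∈ K) {x y : E} (hx : x ∈ K) (hy : y ∈ K) :
    (1 / 2 : ℝ) • (x - y) ∈ K := by
  have h := hK hx (hneg y hy) (a := 1 / 2) (b := 1 / 2) (by norm_num) (by norm_num) (by norm_num)
  rwa [← smul_add, ← sub_eq_add_neg] at h

theorem IsSymmConvexBody.mem_nhds_zero {n : ℕ} {K : Set (EuclideanSpace ℝ (Fin n))}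
    (hK : IsSymmConvexBody K) : K ∈ nhds 0 := by
  obtain ⟨x, hx⟩ := hK.nonempty_interior
  have hx' : -x ∈ interior K := by
    have h := (Homeomorph.neg (EuclideanSpace ℝ (Fin n))).preimage_interior K
    rw [Homeomorph.coe_neg, Set.neg_preimage, Set.neg_preimage, hK.symm] at h
    rw [← h]; simpa using hx
  have h := hK.convex.interior hx hx' (a := 1 / 2) (b := 1 / 2) (by norm_num) (by norm_num)
    (by norm_num)
  rw [smul_neg, add_neg_cancel] at h
  exact mem_interior_iff_mem_nhds.1 h

theorem IsSymmConvexBody.zero_mem {n : ℕ} {K : Set (EuclideanSpace ℝ (Fin n))}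
    (hK : IsSymmConvexBody K) : (0 : EuclideanSpace ℝ (Fin n)) ∈ K :=
  mem_of_mem_nhds hK.mem_nhds_zero

theorem convex_polarBody {n : ℕ} (L : Set (EuclideanSpace ℝ (Fin n))) :
    Convex ℝ (polarBody L) := by
  intro x hx y hy a b ha hb hab z hz
  rw [inner_add_left, real_inner_smul_left, real_inner_smul_left]
  nlinarith [hx z hz, hy z hz]

theorem isClosed_polarBody {n : ℕ} (L : Set (EuclideanSpace ℝ (Fin n))) :
    IsClosed (polarBody L) := by
  simp only [polarBody, Set.ofPred_forall]
  exact isClosed_biInter fun y _ => isClosed_le (by fun_prop) continuous_const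

theorem zero_mem_polarBody {n : ℕ} (L : Set (EuclideanSpace ℝ (Fin n))) :
    (0 : EuclideanSpace ℝ (Fin n)) ∈ polarBody L := by
  intro y _; simp

/-- One half of the bipolar theorem. -/
theorem mem_of_forall_polarBody_inner_le_one {n : ℕ} {T : Set (EuclideanSpace ℝ (Fin n))}
    (hT : IsSymmConvexBody T) {x : EuclideanSpace ℝ (Fin n)}
    (hx : ∀ y ∈ polarBody T, inner ℝ y x ≤ 1) : x ∈ T := by
  by_contra hxT
  obtain ⟨f, u, hf, hu⟩ :=
    geometric_hahn_banach_closed_point hT.convex hT.isCompact.isClosed hxT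
  have hu0 : 0 < u := by simpa using hf 0 hT.zero_mem
  have hin : ∀ z, inner ℝ (u⁻¹ • (InnerProductSpace.toDual ℝ _).symm f) z = u⁻¹ * f z := by
    intro z; rw [real_inner_smul_left, InnerProductSpace.toDual_symm_apply]
  have h := hx (u⁻¹ • (InnerProductSpace.toDual ℝ _).symm f) fun z hz => by
    rw [hin, inv_mul_le_iff₀ hu0]; linarith [hf z hz]
  rw [hin, inv_mul_le_iff₀ hu0] at h
  linarith

/-! ### Separated sets and chaining over scales -/

/-- A maximal subset of a compact set `Q` that is separated by the functionals in a bounded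
symmetric set `X`. -/
theorem exists_maximal_separated {F : Type*} [NormedAddCommGroup F] [InnerProductSpace ℝ F]
    {X Q : Set F} (hQ : IsCompact Q) (hneg : ∀ x ∈ X, -x ∈ X) {h : ℝ} (hh : 0 < h)
    (hX : ∀ x ∈ X, ‖x‖ ≤ h) {ε : ℝ} (hε : 0 < ε) :
    ∃ Y : Finset F, (∀ y ∈ Y, y ∈ Q) ∧
      (∀ y ∈ Y, ∀ y' ∈ Y, y ≠ y' → ∃ x ∈ X, ε < inner ℝ (y - y') x) ∧
      ∀ q ∈ Q, ∃ y ∈ Y, ∀ x ∈ X, inner ℝ (q - y) x ≤ ε := by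
  classical
  let S : Finset F → Prop := fun Y => (∀ y ∈ Y, y ∈ Q) ∧
      ∀ y ∈ Y, ∀ y' ∈ Y, y ≠ y' → ∃ x ∈ X, ε < inner ℝ (y - y') x
  obtain ⟨t, -, htf, ht⟩ := hQ.finite_cover_balls (e := ε / (2 * h)) (by positivity)
  have hbound : ∀ Y, S Y → Y.card ≤ htf.toFinset.card := by
    intro Y hY
    choose! g hg using fun y (hy : y ∈ Q) => Set.mem_iUnion₂.1 (ht hy)
    refine Finset.card_le_card_of_injOn g (fun y hy => ?_) fun y hy y' hy' hyy' => ?_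
    · obtain ⟨h1, -⟩ := hg y (hY.1 y hy)
      simpa using h1
    · by_contra hne
      obtain ⟨x, hx, hlt⟩ := hY.2 y hy y' hy' hne
      obtain ⟨-, h1⟩ := hg y (hY.1 y hy)
      obtain ⟨-, h2⟩ := hg y' (hY.1 y' hy')
      rw [← hyy', Metric.mem_ball] at h2
      rw [Metric.mem_ball] at h1
      have h3 : ‖y - y'‖ ≤ ε / h := by
        rw [← dist_eq_norm]
        have h4 := dist_triangle_right y y' (g y)
        have h5 : ε / h = ε / (2 * h) + ε / (2 * h) := by field_simp; norm_num
        linarith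
      have h6 := real_inner_le_norm (y - y') x
      have h7 : ‖y - y'‖ * ‖x‖ ≤ ε / h * h :=
        mul_le_mul h3 (hX x hx) (norm_nonneg _) (by positivity)
      rw [div_mul_cancel₀ _ hh.ne'] at h7
      linarith
  let N := Nat.findGreatest (fun k => ∃ Y, S Y ∧ Y.card = k) htf.toFinset.card
  obtain ⟨Y, hY, hYN⟩ : ∃ Y, S Y ∧ Y.card = N :=
    Nat.findGreatest_spec (P := fun k => ∃ Y, S Y ∧ Y.card = k) (Nat.zero_le _)
      ⟨∅, by simp [S], rfl⟩
  refine ⟨Y, hY.1, hY.2, fun q hq => ?_⟩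
  by_contra! hcon
  have hqY : q ∉ Y := by
    intro hqY
    obtain ⟨x, hx, hlt⟩ := hcon q hqY
    simp at hlt; linarith
  have hS : S (insert q Y) := by
    refine ⟨fun y hy => ?_, fun y hy y' hy' hne => ?_⟩
    · rcases Finset.mem_insert.1 hy with rfl | hy
      exacts [hq, hY.1 y hy]
    · rcases Finset.mem_insert.1 hy with rfl | hyY <;>
        rcases Finset.mem_insert.1 hy' with rfl | hyY'
      · exact absurd rfl hne
      · exact hcon y' hyY'
      · obtain ⟨x, hx, hlt⟩ := hcon y hyY
        refine ⟨-x, hneg x hx, ?_⟩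
        rwa [← neg_sub, inner_neg_neg]
      · exact hY.2 y hyY y' hyY' hne
  have h1 := Nat.le_findGreatest (P := fun k => ∃ Y, S Y ∧ Y.card = k) (hbound _ hS)
    ⟨_, hS, rfl⟩
  rw [Finset.card_insert_of_notMem hqY, hYN] at h1
  exact absurd h1 (by simp [N])

/-- A bounded symmetric set `X` is covered by few translates of `T`, in terms of the cardinality
of a subset of the polar of `T` that is separated by `X`. -/
theorem exists_separated_cover_window {n : ℕ} {T X : Set (EuclideanSpace ℝ (Fin n))}
    (hT : IsSymmConvexBody T) (hQ : ∀ y ∈ polarBody T, ‖y‖ ≤ 1) (hneg : ∀ x ∈ X, -x ∈ X)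
    {h : ℝ} (hh : 0 < h) (hX : ∀ x ∈ X, ‖x‖ ≤ h) {m : ℕ} (hm : 0 < m) (hhm : 2 * h ≤ 2 ^ m) :
    ∃ Y C : Finset (EuclideanSpace ℝ (Fin n)), (∀ y ∈ Y, y ∈ polarBody T) ∧
      (∀ y ∈ Y, ∀ y' ∈ Y, y ≠ y' → ∃ x ∈ X, 1 / (8 * m) < inner ℝ (y - y') x) ∧
      C.card ≤ Y.card ^ m ∧ ∀ x ∈ X, ∃ c ∈ C, x - c ∈ T := by
  classical
  have hm' : (0 : ℝ) < m := by exact_mod_cast hm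
  have hcomp : IsCompact (polarBody T) :=
    Metric.isCompact_of_isClosed_isBounded (isClosed_polarBody T)
      (isBounded_iff_forall_norm_le.2 ⟨1, hQ⟩)
  obtain ⟨Y, hYQ, hsep, hmax⟩ := exists_maximal_separated hcomp hneg hh hX
    (ε := 1 / (8 * (m : ℝ))) (by positivity)
  obtain ⟨y₀, hy₀, -⟩ := hmax 0 (zero_mem_polarBody T)
  choose g hgY hg using hmax
  let cl : EuclideanSpace ℝ (Fin n) → Y := fun y =>
    if hy : y ∈ polarBody T then ⟨g y hy, hgY y hy⟩ else ⟨y₀, hy₀⟩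
  obtain ⟨C, hC, hcov⟩ := exists_cover_of_classes (X := X) (convex_polarBody T)
    (isClosed_polarBody T) ⟨0, zero_mem_polarBody T⟩ hQ cl hm (fun y hy y' hy' hyy' x hx x' hx' => by
      simp only [cl, dif_pos hy, dif_pos hy', Subtype.mk.injEq] at hyy'
      have h1 := hg y hy x hx
      have h2 := hg y hy (-x') (hneg x' hx')
      have h3 := hg y' hy' (-x) (hneg x hx)
      have h4 := hg y' hy' x' hx'
      rw [← hyy'] at h3 h4
      simp only [inner_sub_left, inner_sub_right, inner_neg_right] at h1 h2 h3 h4 ⊢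
      -- Passing from `y` and `y'` to their common net point, tested on `x` and `x'`, costs four
      -- errors `1 / (8 * m)`.
      have h5 : 1 / (2 * (m : ℝ)) = 4 * (1 / (8 * m)) := by field_simp; norm_num
      linarith) hh hX hhm
  refine ⟨Y, C, hYQ, hsep, by simpa using hC, fun x hx => ?_⟩
  obtain ⟨c, hc, h1⟩ := hcov x hx
  exact ⟨c, hc, mem_of_forall_polarBody_inner_le_one hT h1⟩

/-- Chaining over the scales `ρ ^ L, …, ρ, 1`: a symmetric convex set is covered by few translates
of `T`, in terms of the cardinalities of two separated subsets of twice the polar of `T`. The sets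
collect the contributions of every other scale. -/
theorem exists_separated_cover {n : ℕ} {T : Set (EuclideanSpace ℝ (Fin n))}
    (hT : IsSymmConvexBody T) (hQ : ∀ y ∈ polarBody T, ‖y‖ ≤ 1) {R : ℝ} (hR : 0 < R)
    (hTR : ∀ x ∈ T, ‖x‖ ≤ R) {m : ℕ} (hm : 0 < m) {ρ : ℝ} (hρ : 128 * m ≤ ρ)
    (hRm : 4 * ρ * R ≤ 2 ^ m) (L : ℕ) :
    ∀ K : Set (EuclideanSpace ℝ (Fin n)), Convex ℝ K → (∀ x ∈ K, -x ∈ K) →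
      (0 : EuclideanSpace ℝ (Fin n)) ∈ K → (∀ x ∈ K, (ρ ^ L)⁻¹ • x ∈ T) →
      ∃ Z W C : Finset (EuclideanSpace ℝ (Fin n)),
        (∀ z ∈ Z, ∀ x ∈ T, inner ℝ z x ≤ 2) ∧
        (∀ z ∈ W, ∀ x ∈ T, inner ℝ z x ≤ 2) ∧
        (∀ z ∈ Z, ∀ z' ∈ Z, z ≠ z' → ∃ u ∈ K, 1 / (32 * m) < inner ℝ (z - z') u) ∧
        (∀ z ∈ W, ∀ z' ∈ W, z ≠ z' → ∃ u, ρ • u ∈ K ∧ 1 / (32 * m) < inner ℝ (z - z') u) ∧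
        C.card ≤ (Z.card * W.card) ^ m ∧ ∀ x ∈ K, ∃ c ∈ C, x - c ∈ T := by
  classical
  have hm1 : (1 : ℝ) ≤ m := by exact_mod_cast hm
  have hρ1 : 128 ≤ ρ := by linarith
  have hρ0 : 0 < ρ := by linarith
  induction L with
  | zero =>
    intro K _ _ _ hKT
    refine ⟨{0}, {0}, {0}, by simp, by simp, by simp, by simp, by simp, fun x hx => ?_⟩
    exact ⟨0, by simp, by simpa using hKT x hx⟩
  | succ L ih =>
    intro K hconv hneg h0 hKT
    obtain ⟨Z, W, C, hZ, hW, hZs, hWs, hC, hcov⟩ := ih {x | ρ • x ∈ K}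
      (hconv.smul_preimage ρ) (fun x hx => by
        show ρ • -x ∈ K
        rw [smul_neg]; exact hneg _ hx) (by simpa using h0) (fun x hx => by
        have h := hKT _ hx
        rwa [smul_smul, pow_succ, mul_inv, mul_assoc, inv_mul_cancel₀ hρ0.ne', mul_one] at h)
    have hTneg : ∀ x ∈ T, -x ∈ T := fun x => hT.neg_mem
    -- `X` is `2K ∩ 2ρT`, which holds what is left of `K` after the coarser scales.
    let X : Set (EuclideanSpace ℝ (Fin n)) := {x | (1 / 2 : ℝ) • x ∈ K ∧ (2 * ρ)⁻¹ • x ∈ T}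
    have hXnorm : ∀ x ∈ X, ‖x‖ ≤ 2 * ρ * R := by
      intro x hx
      have h := hTR _ hx.2
      rwa [norm_smul, norm_inv, Real.norm_of_nonneg (by positivity),
        inv_mul_le_iff₀ (by positivity)] at h
    obtain ⟨Y, D, hYQ, hYs, hD, hDcov⟩ := exists_separated_cover_window hT hQ (X := X)
      (fun x hx => ⟨by rw [smul_neg]; exact hneg _ hx.1, by rw [smul_neg]; exact hTneg _ hx.2⟩)
      (h := 2 * ρ * R) (by positivity) hXnorm hm (by linarith)
    -- `W` is separated two scales up, by vectors `u` with `ρ² • u` in `K`; the weight `ρ⁻²`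
    -- compensates exactly for this dilation.
    let f : EuclideanSpace ℝ (Fin n) × EuclideanSpace ℝ (Fin n) → EuclideanSpace ℝ (Fin n) :=
      fun p => p.1 + (ρ ^ 2)⁻¹ • p.2
    have hsep : ∀ p ∈ Y ×ˢ W, ∀ p' ∈ Y ×ˢ W, p ≠ p' →
        ∃ u ∈ K, 1 / (32 * m) < inner ℝ (f p - f p') u := by
      rintro ⟨y, z⟩ hp ⟨y', z'⟩ hp' hne
      rw [Finset.mem_product] at hp hp'
      have e : f (y, z) - f (y', z') = (y - y') + (ρ ^ 2)⁻¹ • (z - z') := by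
        simp only [f, smul_sub]; abel
      by_cases hyy : y = y'
      · obtain ⟨u, hu, hlt⟩ := hWs z hp.2 z' hp'.2 fun hzz => hne (by rw [hyy, hzz])
        refine ⟨ρ • ρ • u, hu, ?_⟩
        rw [e, hyy, sub_self, zero_add, real_inner_smul_left, real_inner_smul_right,
          real_inner_smul_right]
        have : (ρ ^ 2)⁻¹ * (ρ * (ρ * inner ℝ (z - z') u)) = inner ℝ (z - z') u := by
          field_simp
        rwa [this]
      · obtain ⟨x, hx, hlt⟩ := hYs y hp.1 y' hp'.1 hyy
        refine ⟨(1 / 2 : ℝ) • x, hx.1, ?_⟩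
        -- As `x` lies in `2ρT`, the `W` part is at least `-8ρ / ρ²`, which spoils at most half of
        -- the separation `1 / (8 * m)`. Skipping a scale is what makes this small.
        have h1 := hW z hp.2 (-((2 * ρ)⁻¹ • x)) (hTneg _ hx.2)
        have h2 := hW z' hp'.2 _ hx.2
        rw [inner_neg_right] at h1
        rw [real_inner_smul_right] at h1 h2
        have h3 : -(8 * ρ) ≤ inner ℝ (z - z') x := by
          rw [inner_sub_left]
          have h4 : (2 * ρ)⁻¹ * (inner ℝ z' x - inner ℝ z x) ≤ 4 := by linarith
          rw [inv_mul_le_iff₀ (by positivity)] at h4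
          linarith
        have h5 : -(1 / (16 * (m : ℝ))) ≤ (ρ ^ 2)⁻¹ * inner ℝ (z - z') x := by
          have h6 : (ρ ^ 2)⁻¹ * -(8 * ρ) ≤ (ρ ^ 2)⁻¹ * inner ℝ (z - z') x :=
            mul_le_mul_of_nonneg_left h3 (by positivity)
          have h7 : (ρ ^ 2)⁻¹ * -(8 * ρ) = -(8 / ρ) := by field_simp
          have h8 : 8 / ρ ≤ 1 / (16 * m) := by
            rw [div_le_div_iff₀ hρ0 (by positivity)]; linarith
          linarith
        rw [e, inner_add_left, real_inner_smul_left, real_inner_smul_right, real_inner_smul_right]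
        have h9 : 1 / (8 * (m : ℝ)) = 4 * (1 / (32 * m)) := by field_simp; norm_num
        have h10 : 1 / (16 * (m : ℝ)) = 2 * (1 / (32 * m)) := by field_simp; norm_num
        linarith
    have hinj : Set.InjOn f (Y ×ˢ W : Finset _) := by
      intro p hp p' hp' hpp
      by_contra hne
      obtain ⟨u, -, hlt⟩ := hsep p hp p' hp' hne
      rw [hpp, sub_self, inner_zero_left] at hlt
      exact absurd hlt (not_lt.2 (by positivity))
    -- Recentring at points of `K` puts the differences in `2K` as well as in `2ρT`.
    have hcen : ∀ c, ∃ u, (∃ x ∈ K, ρ⁻¹ • x - c ∈ T) → u ∈ K ∧ ρ⁻¹ • u - c ∈ T := by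
      intro c
      by_cases hc : ∃ x ∈ K, ρ⁻¹ • x - c ∈ T
      · exact ⟨hc.choose, fun _ => hc.choose_spec⟩
      · exact ⟨0, fun h => absurd h hc⟩
    choose g hg using hcen
    -- The parities swap: the new scale joins `W`, and the old `Z` is now one scale away.
    refine ⟨(Y ×ˢ W).image f, Z, (C ×ˢ D).image fun p => g p.1 + p.2, ?_, hZ, ?_, hZs, ?_, ?_⟩
    · intro v hv x hx
      obtain ⟨p, hp, rfl⟩ := Finset.mem_image.1 hv
      rw [Finset.mem_product] at hp
      simp only [f, inner_add_left, real_inner_smul_left]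
      have h1 := hYQ _ hp.1 x hx
      have h2 := hW _ hp.2 x hx
      have h3 : (ρ ^ 2)⁻¹ * inner ℝ p.2 x ≤ 1 := by
        rw [inv_mul_le_iff₀ (by positivity)]; nlinarith
      linarith
    · intro v hv v' hv' hne
      obtain ⟨p, hp, rfl⟩ := Finset.mem_image.1 hv
      obtain ⟨p', hp', rfl⟩ := Finset.mem_image.1 hv'
      exact hsep p hp p' hp' fun h => hne (by rw [h])
    · calc _ ≤ (C ×ˢ D).card := Finset.card_image_le
        _ = C.card * D.card := Finset.card_product _ _
        _ ≤ (Z.card * W.card) ^ m * Y.card ^ m := Nat.mul_le_mul hC hD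
        _ = _ := by
          rw [Finset.card_image_of_injOn hinj, Finset.card_product, ← mul_pow]; congr 1; ring
    · intro x hx
      obtain ⟨c, hc, hxc⟩ := hcov (ρ⁻¹ • x) (by
        show ρ • ρ⁻¹ • x ∈ K
        rwa [smul_inv_smul₀ hρ0.ne'])
      obtain ⟨huK, huT⟩ := hg c ⟨x, hx, hxc⟩
      obtain ⟨d, hd, hxd⟩ := hDcov (x - g c) ⟨hconv.half_smul_sub_mem hneg hx huK, by
        have h := hT.convex.half_smul_sub_mem hTneg hxc huT
        rwa [sub_sub_sub_cancel_right, ← smul_sub, smul_smul, one_div, ← mul_inv] at h⟩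
      refine ⟨g c + d, Finset.mem_image.2 ⟨(c, d), Finset.mem_product.2 ⟨hc, hd⟩, rfl⟩, ?_⟩
      rwa [← sub_sub]

/-- A symmetric convex body `K` is covered by few translates of `T`, in terms of a classification
of the polar of `T` by the action on `K`. -/
theorem exists_cover_of_polar_classes {n : ℕ} {K T : Set (EuclideanSpace ℝ (Fin n))}
    (hK : IsSymmConvexBody K) (hT : IsSymmConvexBody T) (hQ : ∀ y ∈ polarBody T, ‖y‖ ≤ 1)
    {R : ℝ} (hR : 0 < R) (hTR : ∀ x ∈ T, ‖x‖ ≤ R) {m : ℕ} (hm : 0 < m) {ρ : ℝ}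
    (hρ : 128 * m ≤ ρ) (hRm : 4 * ρ * R ≤ 2 ^ m) {ι : Type*} [Fintype ι]
    (cl : EuclideanSpace ℝ (Fin n) → ι) {η : ℝ} (hη : 128 * m * η ≤ 1)
    (hcl : ∀ y ∈ polarBody T, ∀ y' ∈ polarBody T, cl y = cl y' → ∀ u ∈ K,
      inner ℝ (y - y') u ≤ 2 * η) :
    ∃ C : Finset (EuclideanSpace ℝ (Fin n)), C.card ≤ Fintype.card ι ^ (2 * m) ∧
      ∀ x ∈ K, ∃ c ∈ C, x - c ∈ T := by
  have hm1 : (1 : ℝ) ≤ m := by exact_mod_cast hm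
  have hρ1 : 128 ≤ ρ := by linarith
  obtain ⟨r, hr, hrT⟩ := Metric.mem_nhds_iff.1 hT.mem_nhds_zero
  obtain ⟨B, hB⟩ := isBounded_iff_forall_norm_le.1 hK.isCompact.isBounded
  -- The number of scales depends on the bodies, but the final bound does not involve it.
  obtain ⟨L, hL⟩ := pow_unbounded_of_one_lt (B / r) (by linarith : 1 < ρ)
  obtain ⟨Z, W, C, hZ, hW, hZs, hWs, hC, hcov⟩ := exists_separated_cover hT hQ hR hTR hm hρ hRm L K
    hK.convex (fun x => hK.neg_mem) hK.zero_mem (fun x hx => hrT (by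
      rw [mem_ball_zero_iff, norm_smul, norm_inv, Real.norm_of_nonneg (by positivity),
        inv_mul_lt_iff₀ (by positivity)]
      exact (hB x hx).trans_lt ((div_lt_iff₀ hr).1 hL)))
  have key : ∀ V : Finset (EuclideanSpace ℝ (Fin n)), (∀ z ∈ V, ∀ x ∈ T, inner ℝ z x ≤ 2) →
      (∀ z ∈ V, ∀ z' ∈ V, z ≠ z' → ∃ u ∈ K, 1 / (32 * m) < inner ℝ (z - z') u) →
      V.card ≤ Fintype.card ι := by
    intro V hV hVs
    refine Finset.card_le_card_of_injOn (t := Finset.univ) (fun z => cl ((1 / 2 : ℝ) • z))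
      (fun _ _ => Finset.mem_coe.2 (Finset.mem_univ _)) fun z hz z' hz' hzz => ?_
    by_contra hne
    obtain ⟨u, hu, hlt⟩ := hVs z hz z' hz' hne
    have hmem : ∀ v ∈ V, (1 / 2 : ℝ) • v ∈ polarBody T := by
      intro v hv x hx
      rw [real_inner_smul_left]; linarith [hV v hv x hx]
    have h := hcl _ (hmem z hz) _ (hmem z' hz') hzz u hu
    rw [← smul_sub, real_inner_smul_left] at h
    have h2 : 4 * η ≤ 1 / (32 * m) := by rw [le_div_iff₀ (by positivity)]; linarith
    linarith
  refine ⟨C, hC.trans ?_, hcov⟩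
  rw [pow_mul, sq]
  refine Nat.pow_le_pow_left (Nat.mul_le_mul (key Z hZ hZs) (key W hW ?_)) m
  intro z hz z' hz' hne
  obtain ⟨u, hu, hlt⟩ := hWs z hz z' hz' hne
  refine ⟨ρ • u, hu, hlt.trans_le ?_⟩
  rw [real_inner_smul_right]
  have : 0 < 1 / (32 * (m : ℝ)) := by positivity
  nlinarith

/-! ### Auerbach position -/

/-- A symmetric convex body has an Auerbach system: a square matrix with rows in the body whose
determinant, in absolute value, cannot be increased by replacing a row by a point of the body. -/
theorem IsSymmConvexBody.exists_det_maximal {n : ℕ} {T : Set (EuclideanSpace ℝ (Fin n))}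
    (hT : IsSymmConvexBody T) : ∃ M : Matrix (Fin n) (Fin n) ℝ, M.det ≠ 0 ∧
      (∀ i, WithLp.toLp 2 (M i) ∈ T) ∧ ∀ i, ∀ x ∈ T, |(M.updateRow i x).det| ≤ |M.det| := by
  have hcomp : IsCompact (Set.univ.pi fun _ : Fin n => T) := isCompact_univ_pi fun _ => hT.isCompact
  let D : (Fin n → EuclideanSpace ℝ (Fin n)) → ℝ := fun v => |(Matrix.of fun i j => v i j).det|
  have hD : Continuous D := by
    refine (Continuous.matrix_det ?_).abs
    fun_prop
  obtain ⟨v, hv, hmax⟩ := hcomp.exists_isMaxOn ⟨0, fun i _ => hT.zero_mem⟩ hD.continuousOn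
  obtain ⟨r, hr, hrT⟩ := Metric.mem_nhds_iff.1 hT.mem_nhds_zero
  refine ⟨Matrix.of fun i j => v i j, ?_, fun i => hv i trivial, fun i x hx => ?_⟩
  · have h := hmax (a := fun i => EuclideanSpace.single i (r / 2)) fun i _ => hrT (by
      simp [abs_of_pos hr, hr])
    have h1 : (Matrix.of fun i j => (EuclideanSpace.single i (r / 2) : EuclideanSpace ℝ (Fin n)) j) =
        Matrix.diagonal fun _ => r / 2 := by
      ext i j
      simp [Matrix.diagonal_apply, eq_comm]
    have h2 : D v ≥ |(r / 2) ^ n| := by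
      have h3 : D _ ≤ D v := h
      simp only [D, h1, Matrix.det_diagonal, Finset.prod_const, Finset.card_univ,
        Fintype.card_fin] at h3
      exact h3
    have h4 : 0 < |(r / 2) ^ n| := by positivity
    exact abs_pos.1 (h4.trans_le h2)
  · have h := hmax (a := Function.update v i x) fun j _ => by
      rcases eq_or_ne j i with rfl | hj
      · simpa using hx
      · simpa [hj] using hv j trivial
    have h1 : (Matrix.of fun k j => Function.update v i x k j) =
        (Matrix.of fun k j => v k j).updateRow i x := by
      ext k j
      rcases eq_or_ne k i with rfl | hk
      · simp
      · simp [hk]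
    have h3 : D _ ≤ D v := h
    simp only [D, h1] at h3
    exact h3

/-- Every symmetric convex body has a linear image that lies between the cross-polytope and the
cube, both dilated by `√n`. -/
theorem IsSymmConvexBody.exists_position {n : ℕ} {T : Set (EuclideanSpace ℝ (Fin n))}
    (hT : IsSymmConvexBody T) :
    ∃ A : EuclideanSpace ℝ (Fin n) ≃L[ℝ] EuclideanSpace ℝ (Fin n),
      (∀ y ∈ polarBody (A '' T), ‖y‖ ≤ 1) ∧ ∀ x ∈ A '' T, ‖x‖ ≤ n := by
  rcases Nat.eq_zero_or_pos n with rfl | hn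
  · refine ⟨.refl ℝ _, fun y _ => ?_, fun x _ => ?_⟩ <;> simp [Subsingleton.elim _ (0 : EuclideanSpace ℝ (Fin 0))]
  have hn0 : (0 : ℝ) < n := by exact_mod_cast hn
  have hs0 : 0 < Real.sqrt n := Real.sqrt_pos.2 hn0
  have hsq : Real.sqrt n ^ 2 = n := Real.sq_sqrt hn0.le
  obtain ⟨M, hM0, hMT, hmax⟩ := hT.exists_det_maximal
  let e := WithLp.linearEquiv 2 ℝ (Fin n → ℝ)
  -- By Cramer's rule these are the coordinates in the Auerbach basis times `√n`; maximality bounds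
  -- them by `√n` on `T`.
  let A₀ : EuclideanSpace ℝ (Fin n) →ₗ[ℝ] EuclideanSpace ℝ (Fin n) :=
    (Real.sqrt n / M.det) • (e.symm.toLinearMap ∘ₗ Matrix.cramer M.transpose ∘ₗ e.toLinearMap)
  have hA₀ : ∀ x i, A₀ x i = Real.sqrt n / M.det * (M.updateRow i x).det := by
    intro x i
    simp [A₀, e, Matrix.cramer_transpose_apply]
  have hrow : ∀ i, A₀ (WithLp.toLp 2 (M i)) = EuclideanSpace.single i (Real.sqrt n) := by
    intro i
    ext j
    rw [hA₀, ← Matrix.cramer_transpose_apply, Matrix.cramer_transpose_row_self]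
    by_cases h : j = i
    · subst h; simp; field_simp
    · simp [h]
  have hsurj : Function.Surjective A₀ := by
    intro y
    refine ⟨∑ i, ((Real.sqrt n)⁻¹ * y i) • WithLp.toLp 2 (M i), ?_⟩
    rw [map_sum]
    simp only [map_smul, hrow]
    ext j
    simp [Pi.single_apply]
    field_simp
  let A : EuclideanSpace ℝ (Fin n) ≃L[ℝ] EuclideanSpace ℝ (Fin n) :=
    (LinearEquiv.ofBijective A₀
      ⟨LinearMap.injective_iff_surjective.2 hsurj, hsurj⟩).toContinuousLinearEquiv
  have hA : ∀ x, A x = A₀ x := fun x => rfl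
  refine ⟨A, fun y hy => ?_, ?_⟩
  · have hyi : ∀ i, y i ^ 2 ≤ 1 / n := by
      intro i
      have h1 := hy _ ⟨_, hMT i, rfl⟩
      have h2 := hy _ ⟨_, hT.neg_mem (hMT i), rfl⟩
      rw [map_neg, inner_neg_right] at h2
      rw [hA, hrow, EuclideanSpace.inner_single_right] at h1 h2
      simp only [conj_trivial] at h1 h2
      rw [le_div_iff₀ hn0, ← hsq, ← mul_pow]
      rw [sq_le_one_iff_abs_le_one, abs_le]
      constructor <;> linarith
    have h : ‖y‖ ^ 2 ≤ 1 := by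
      rw [EuclideanSpace.norm_sq_eq]
      calc ∑ i, ‖y i‖ ^ 2 ≤ ∑ _i : Fin n, 1 / (n : ℝ) :=
            Finset.sum_le_sum fun i _ => by rw [Real.norm_eq_abs, sq_abs]; exact hyi i
        _ = 1 := by simp; field_simp
    exact (sq_le_one_iff₀ (norm_nonneg _)).1 h
  · rintro _ ⟨x, hx, rfl⟩
    have h : ‖A x‖ ^ 2 ≤ (n : ℝ) ^ 2 := by
      rw [EuclideanSpace.norm_sq_eq]
      calc ∑ i, ‖A x i‖ ^ 2 ≤ ∑ _i : Fin n, (n : ℝ) := Finset.sum_le_sum fun i _ => by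
            rw [hA, hA₀, Real.norm_eq_abs, abs_mul, abs_div, abs_of_pos hs0, div_mul_eq_mul_div,
              mul_div_assoc]
            have h1 : |(M.updateRow i x).det| / |M.det| ≤ 1 :=
              div_le_one_of_le₀ (hmax i x hx) (abs_nonneg _)
            rw [mul_pow, hsq]
            exact mul_le_of_le_one_right hn0.le (pow_le_one₀ (by positivity) h1)
        _ = (n : ℝ) ^ 2 := by simp; ring
    exact (sq_le_sq₀ (norm_nonneg _) hn0.le).1 h

theorem IsSymmConvexBody.image {n : ℕ} {K : Set (EuclideanSpace ℝ (Fin n))}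
    (hK : IsSymmConvexBody K)
    (A : EuclideanSpace ℝ (Fin n) ≃L[ℝ] EuclideanSpace ℝ (Fin n)) : IsSymmConvexBody (A '' K) where
  convex := hK.convex.linear_image A.toLinearEquiv.toLinearMap
  isCompact := hK.isCompact.image A.continuous
  nonempty_interior := by
    have h := A.toHomeomorph.image_interior K
    rw [ContinuousLinearEquiv.coe_toHomeomorph] at h
    rw [← h]
    exact hK.nonempty_interior.image A
  symm := by
    ext x
    constructor
    · rintro ⟨y, hy, hyx⟩
      exact ⟨-y, hK.neg_mem hy, by rw [map_neg, hyx, neg_neg]⟩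
    · rintro ⟨y, hy, rfl⟩
      exact ⟨-y, hK.neg_mem hy, map_neg A y⟩

/-- The covering bound for symmetric convex bodies in arbitrary position. -/
theorem exists_cover_of_polar_classes_of_position {n : ℕ} (hn : 1 ≤ n)
    {K T : Set (EuclideanSpace ℝ (Fin n))}
    (hK : IsSymmConvexBody K) (hT : IsSymmConvexBody T) {m : ℕ} (hm : 0 < m)
    (hnm : 512 * m * n ≤ 2 ^ m) {ι : Type*} [Fintype ι]
    (cl : EuclideanSpace ℝ (Fin n) → ι) {η : ℝ} (hη : 128 * m * η ≤ 1)
    (hcl : ∀ y ∈ polarBody T, ∀ y' ∈ polarBody T, cl y = cl y' → ∀ u ∈ K,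
      inner ℝ (y - y') u ≤ 2 * η) :
    ∃ C : Finset (EuclideanSpace ℝ (Fin n)), C.card ≤ Fintype.card ι ^ (2 * m) ∧
      ∀ x ∈ K, ∃ c ∈ C, x - c ∈ T := by
  classical
  obtain ⟨A, hA1, hA2⟩ := hT.exists_position
  let B := ContinuousLinearMap.adjoint (A : EuclideanSpace ℝ (Fin n) →L[ℝ] EuclideanSpace ℝ (Fin n))
  have hB : ∀ y x, inner ℝ (B y) x = inner ℝ y (A x) := fun y x =>
    ContinuousLinearMap.adjoint_inner_left _ x y
  have hBT : ∀ y ∈ polarBody (A '' T), B y ∈ polarBody T := by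
    intro y hy x hx
    rw [hB]; exact hy _ ⟨x, hx, rfl⟩
  obtain ⟨C, hC, hcov⟩ := exists_cover_of_polar_classes (hK.image A) (hT.image A) hA1
    (R := n) (by exact_mod_cast hn) hA2 hm (ρ := 128 * m) le_rfl
    (by have h : (512 * m * n : ℝ) ≤ 2 ^ m := by exact_mod_cast hnm
        linarith) (fun y => cl (B y)) hη
    (by
      rintro y hy y' hy' hyy _ ⟨u, hu, rfl⟩
      have h := hcl _ (hBT y hy) _ (hBT y' hy') hyy u hu
      rwa [← map_sub, hB] at h)
  refine ⟨C.image A.symm, Finset.card_image_le.trans hC, fun x hx => ?_⟩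
  obtain ⟨c, hc, t, ht, htx⟩ := hcov (A x) ⟨x, hx, rfl⟩
  refine ⟨A.symm c, Finset.mem_image_of_mem _ hc, ?_⟩
  have h : x - A.symm c = t := by
    apply A.injective
    rw [map_sub, A.apply_symm_apply, htx]
  rwa [h]

/-! ### Covering numbers and the choice of constants -/

theorem IsSymmConvexBody.isCompact_polarBody {n : ℕ} {T : Set (EuclideanSpace ℝ (Fin n))}
    (hT : IsSymmConvexBody T) : IsCompact (polarBody T) := by
  obtain ⟨r, hr, hrT⟩ := Metric.mem_nhds_iff.1 hT.mem_nhds_zero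
  refine Metric.isCompact_of_isClosed_isBounded (isClosed_polarBody T)
    (isBounded_iff_forall_norm_le.2 ⟨2 / r, fun y hy => ?_⟩)
  rcases eq_or_ne y 0 with rfl | hy0
  · rw [norm_zero]; positivity
  have hy0' : 0 < ‖y‖ := norm_pos_iff.2 hy0
  have h := hy ((r / 2 * ‖y‖⁻¹) • y) (hrT (by
    rw [mem_ball_zero_iff, norm_smul, Real.norm_of_nonneg (by positivity), mul_assoc,
      inv_mul_cancel₀ hy0'.ne']
    linarith))
  rw [real_inner_smul_right, real_inner_self_eq_norm_sq] at h
  have h2 : r / 2 * ‖y‖⁻¹ * ‖y‖ ^ 2 = r / 2 * ‖y‖ := by field_simp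
  rw [le_div_iff₀ hr]
  linarith

theorem IsSymmConvexBody.polarBody_mem_nhds_zero {n : ℕ} {K : Set (EuclideanSpace ℝ (Fin n))}
    (hK : IsSymmConvexBody K) : polarBody K ∈ nhds 0 := by
  obtain ⟨B, hB0, hB⟩ := hK.isCompact.isBounded.exists_pos_norm_le
  refine Filter.mem_of_superset (Metric.ball_mem_nhds 0 (inv_pos.2 hB0)) fun y hy x hx => ?_
  rw [mem_ball_zero_iff] at hy
  calc inner ℝ y x ≤ ‖y‖ * ‖x‖ := real_inner_le_norm y x
    _ ≤ B⁻¹ * B := mul_le_mul hy.le (hB x hx) (norm_nonneg _) (by positivity)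
    _ = 1 := inv_mul_cancel₀ hB0.ne'

/-- The covering number `N(K, T)` is bounded by a power of the dual covering number, with an
exponent `2m` and a dilation `η` that depend only on the dimension. -/
theorem coveringNum_le_pow {n : ℕ} (hn : 1 ≤ n) {K T : Set (EuclideanSpace ℝ (Fin n))}
    (hK : IsSymmConvexBody K) (hT : IsSymmConvexBody T) {m : ℕ} (hm : 0 < m)
    (hnm : 512 * m * n ≤ 2 ^ m) {η : ℝ} (hη0 : 0 < η) (hη : 128 * m * η ≤ 1) :
    coveringNum K T ≤ coveringNum (polarBody T) (η • polarBody K) ^ (2 * m) := by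
  classical
  have hint : (interior (η • polarBody K)).Nonempty :=
    ⟨0, mem_interior_iff_mem_nhds.2 ((set_smul_mem_nhds_zero_iff hη0.ne').2
      hK.polarBody_mem_nhds_zero)⟩
  obtain ⟨w, hw⟩ := Nat.sInf_mem (coveringCards_nonempty hT.isCompact_polarBody hint)
  change polarBody T ⊆ _ at hw
  have hex : ∀ y : EuclideanSpace ℝ (Fin n), ∃ i, y ∈ polarBody T → y ∈ w i +ᵥ η • polarBody K := by
    intro y
    by_cases hy : y ∈ polarBody T
    · obtain ⟨i, hi⟩ := Set.mem_iUnion.1 (hw hy)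
      exact ⟨i, fun _ => hi⟩
    · obtain ⟨i, -⟩ := Set.mem_iUnion.1 (hw (zero_mem_polarBody T))
      exact ⟨i, fun h => absurd h hy⟩
  choose cl hcl using hex
  obtain ⟨C, hC, hcov⟩ := exists_cover_of_polar_classes_of_position hn hK hT hm hnm cl hη
    (by
      intro y hy y' hy' hyy u hu
      obtain ⟨_, ⟨v, hv, rfl⟩, hvy⟩ := hcl y hy
      obtain ⟨_, ⟨v', hv', rfl⟩, hvy'⟩ := hcl y' hy'
      rw [← hyy] at hvy'
      have e : y - y' = η • (v - v') := by
        rw [← hvy, ← hvy']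
        simp [smul_sub]
      have h1 := hv u hu
      have h2 := hv' (-u) (hK.neg_mem hu)
      rw [inner_neg_right] at h2
      rw [e, real_inner_smul_left, inner_sub_left]
      nlinarith)
  rw [Fintype.card_fin] at hC
  refine le_trans (Nat.sInf_le ⟨fun i => (C.equivFin.symm i : EuclideanSpace ℝ (Fin n)),
    fun x hx => ?_⟩) hC
  obtain ⟨c, hc, h⟩ := hcov x hx
  refine Set.mem_iUnion.2 ⟨C.equivFin ⟨c, hc⟩, x - c, h, ?_⟩
  simp

theorem corollary2 :
    ∃ C : ℝ, 0 < C ∧ ∀ n : ℕ, 1 ≤ n → ∀ K T : Set (EuclideanSpace ℝ (Fin n)),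
      IsSymmConvexBody K → IsSymmConvexBody T →
        Real.log (coveringNum K T) ≤
          C * Real.log (1 + n) * Real.log (Real.log (2 + n)) *
            Real.log (coveringNum (polarBody T) ((C * Real.log (1 + n))⁻¹ • polarBody K)) := by
  refine ⟨4000, by norm_num, fun n hn K T hK hT => ?_⟩
  have hn1 : (1 : ℝ) ≤ n := by exact_mod_cast hn
  set l := Real.log (1 + n) with hl
  have hl2 : Real.log 2 ≤ l := Real.log_le_log (by norm_num) (by linarith)
  have hlog2 := Real.log_two_gt_d9
  have hl0 : 0.69 < l := by linarith
  obtain ⟨k, hk1, hk2⟩ : ∃ k : ℕ, n ≤ 2 ^ k ∧ 2 ^ k ≤ 2 * n := by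
    refine ⟨Nat.clog 2 n, Nat.le_pow_clog (by norm_num) n, ?_⟩
    rcases hn.eq_or_lt with rfl | hn2
    · simp
    · have h := Nat.pow_pred_clog_lt_self (b := 2) (by norm_num) hn2
      have h2 : 0 < Nat.clog 2 n := Nat.clog_pos (by norm_num) hn2
      have h3 : 2 ^ Nat.clog 2 n = 2 ^ (Nat.clog 2 n).pred * 2 := by
        rw [← pow_succ, Nat.pred_eq_sub_one, Nat.sub_add_cancel h2]
      omega
  have hkl : (k : ℝ) * 0.69 ≤ 2 * l := by
    have h1 : (2 : ℝ) ^ k ≤ (1 + n) ^ 2 := by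
      have h2 : (2 : ℝ) ^ k ≤ 2 * n := by exact_mod_cast hk2
      nlinarith
    have h2 := Real.log_le_log (by positivity) h1
    rw [Real.log_pow, Real.log_pow] at h2
    have h3 : (k : ℝ) * 0.69 ≤ k * Real.log 2 :=
      mul_le_mul_of_nonneg_left (by linarith) (Nat.cast_nonneg k)
    push_cast at h2
    linarith
  -- One factor `2 ^ k` absorbs `n`, the other absorbs `m`, and `2 ^ 14` the constants.
  set m := 14 + 2 * k with hm
  have hml : (m : ℝ) ≤ 27 * l := by
    rw [hm]; push_cast; linarith
  have hnm : 512 * m * n ≤ 2 ^ m := by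
    have h1 : 2 ^ m = 16384 * (2 ^ k * 2 ^ k) := by rw [hm, pow_add, pow_mul']; ring
    have h2 : k < 2 ^ k := Nat.lt_two_pow_self
    rw [h1]
    calc 512 * m * n ≤ 512 * m * 2 ^ k := Nat.mul_le_mul_left _ hk1
      _ ≤ 16384 * 2 ^ k * 2 ^ k := Nat.mul_le_mul_right _ (by omega)
      _ = _ := by ring
  have hη : 128 * m * (4000 * l)⁻¹ ≤ 1 := by
    rw [← div_eq_mul_inv, div_le_one (by positivity)]
    linarith
  have h := coveringNum_le_pow hn hK hT (m := m) (by omega) hnm (η := (4000 * l)⁻¹)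
    (by positivity) hη
  set P := coveringNum (polarBody T) ((4000 * l)⁻¹ • polarBody K)
  have hP : 0 ≤ Real.log P := Real.log_natCast_nonneg P
  have h3 : (1.09 : ℝ) ≤ Real.log (2 + n) := by
    have h4 : Real.log 3 ≤ Real.log (2 + n) := Real.log_le_log (by norm_num) (by linarith)
    have h5 := Real.one_sub_inv_le_log_of_pos (x := 3 / Real.exp 1) (by positivity)
    rw [Real.log_div (by norm_num) (Real.exp_pos 1).ne', Real.log_exp, inv_div] at h5
    have h6 := Real.exp_one_lt_d9
    linarith
  -- Positivity already at `n = 1` rests on `3 > e`.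
  have hll : (0.08 : ℝ) ≤ Real.log (Real.log (2 + n)) := by
    have h4 := Real.one_sub_inv_le_log_of_pos (x := Real.log (2 + n)) (by linarith)
    have h5 : (Real.log (2 + n))⁻¹ ≤ (1.09 : ℝ)⁻¹ := inv_anti₀ (by norm_num) h3
    have h6 : (1.09 : ℝ)⁻¹ ≤ 0.92 := by norm_num
    linarith
  have hexp : (2 * m : ℝ) ≤ 4000 * l * Real.log (Real.log (2 + n)) := by nlinarith
  refine le_trans ?_ (mul_le_mul_of_nonneg_right hexp hP)
  rcases Nat.eq_zero_or_pos (coveringNum K T) with h0 | hpos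
  · rw [h0, Nat.cast_zero, Real.log_zero]; positivity
  · have h7 : (coveringNum K T : ℝ) ≤ (P : ℝ) ^ (2 * m) := by exact_mod_cast h
    have h8 := Real.log_le_log (by exact_mod_cast hpos) h7
    rw [Real.log_pow] at h8
    exact_mod_cast h8
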